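/- Write $\mathbb{R}_+=\{x\in\mathbb{R}:x>0\}$, $\mathbb{C}^*=\mathbb{C}\setminus\{0\}$, and for $x\in\mathbb{C}$, $\ell\in\mathbb{R}^n$ put $\exp(ix\ell)=(e^{ix\ell_1},\dots,e^{ix\ell_n})$. The amoeba of $p\in\mathbb{C}[z_1,\dots,z_n]$ is $$\mathcal{A}(p)=\{(\log|z_1|,\dots,\log|z_n|) : z\in(\mathbb{C}^*)^n,\ p(z)=0\}\subset\mathbb{R}^n.$$ A polynomial $q\in\mathbb{C}[z_1,\dots,z_n]$ is called a Lee–Yang polynomial if it has no zeros in $\Omega^n$, both for $\Omega=\{z\in\mathbb{C}:|z|<1\}$ and for $\Omega=\{z\in\mathbb{C}:|z|>1\}$. Let $p\in\mathbb{C}[z_1,\dots,z_n]$ with $p(0)\neq 0$, and let $\ell\in\mathbb{R}_+^n$ have $\mathbb{Q}$-linearly independent entries. If the set $\{t\ell : t\in\mathbb{R},\ t\neq 0\}$ is disjoint from $\mathcal{A}(p)$, then there exist a Lee–Yang polynomial $q\in\mathbb{C}[z_1,\dots,z_n]$ and a vector $\tilde\ell\in\mathbb{R}_+^n$ with $\mathbb{Q}$-linearly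 independent entries such that $$p(\exp(ix\ell))=q(\exp(ix\tilde\ell))\qquad\text{for all } x\in\mathbb{C}.$$ -/

import Mathlib

/-- The amoeba of `p ∈ ℂ[z₁, …, zₙ]`: the image of the zeros of `p` in `(ℂ \ {0})ⁿ`
under `z ↦ (log |z₁|, …, log |zₙ|)`. -/
def amoeba {n : ℕ} (p : MvPolynomial (Fin n) ℂ) : Set (Fin n → ℝ) :=
  (fun (z : Fin n → ℂ) (j : Fin n) => Real.log ‖z j‖) ''
    {z | (∀ j, z j ≠ 0) ∧ MvPolynomial.eval z p = 0}

/-- `p` is a Lee-Yang polynomial: it has no zeros in `Ωⁿ`, both for the open unit disc `Ω`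
and for the exterior `Ω` of the closed unit disc. -/
def IsLeeYang {n : ℕ} (p : MvPolynomial (Fin n) ℂ) : Prop :=
  (∀ z : Fin n → ℂ, (∀ j, ‖z j‖ < 1) → MvPolynomial.eval z p ≠ 0) ∧
    (∀ z : Fin n → ℂ, (∀ j, 1 < ‖z j‖) → MvPolynomial.eval z p ≠ 0)

/-- The point `exp(i x ℓ) = (e^{i x ℓ₁}, …, e^{i x ℓₙ}) ∈ ℂⁿ`, for `x ∈ ℂ` and `ℓ ∈ ℝⁿ`. -/
noncomputable def expLine {n : ℕ} (l : Fin n → ℝ) (x : ℂ) : Fin n → ℂ :=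
  fun j => Complex.exp (Complex.I * x * (l j : ℂ))

/-! Write `l = V l'` with `V` a natural matrix and `l' > 0`, and let `q` be `p` after the monomial
substitution `z_j ↦ ∏ k, z_k ^ V j k`. Tori of radii `exp (s * l' k)` map into tori over `s • l`, so
`q` has no zeros there for `s ≠ 0`. As `q 0 = p 0 ≠ 0`, `eval_ne_zero_of_tori` clears the open
polydisc. The exterior is the same argument for the reversed polynomial `r`. Its constant term is
one coefficient of `p`, provided a single exponent `m` dominates along every column of `V`;
independence of `l` gives this along `l`, and `exists_nat_matrix` takes the columns close enough to
`l` in direction. -/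

/-- Minimum modulus principle on the closed unit polydisc: a zero-free holomorphic function attains
the minimum of its modulus on the distinguished boundary. -/
theorem le_norm_on_polydisc {n : ℕ} {F : (Fin n → ℂ) → ℂ} (hF : Differentiable ℂ F) {c : ℝ}
    (hc : 0 < c) (h0 : ∀ u : Fin n → ℂ, (∀ j, ‖u j‖ ≤ 1) → F u ≠ 0)
    (hT : ∀ u : Fin n → ℂ, (∀ j, ‖u j‖ = 1) → c ≤ ‖F u‖)
    (u : Fin n → ℂ) (hu : ∀ j, ‖u j‖ ≤ 1) : c ≤ ‖F u‖ := by
  -- `S` holds the coordinates allowed inside the disc; each is released by the one-variable maximum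
  -- principle for `1 / F`.
  suffices H : ∀ (S : Finset (Fin n)) (u : Fin n → ℂ), (∀ j, ‖u j‖ ≤ 1) →
      (∀ j, j ∉ S → ‖u j‖ = 1) → c ≤ ‖F u‖ from H Finset.univ u hu (by simp)
  intro S
  induction S using Finset.induction_on with
  | empty => exact fun u _ h => hT u fun j => h j (by simp)
  | insert k S hk ih =>
    intro u hu hS
    have hle : ∀ w : ℂ, ‖w‖ ≤ 1 → ∀ j, ‖Function.update u k w j‖ ≤ 1 := by
      intro w hw j
      rcases eq_or_ne j k with rfl | hj
      · simpa using hw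
      · simpa [hj] using hu j
    have hupd : Differentiable ℂ fun w : ℂ => Function.update u k w := by
      rw [differentiable_pi]
      intro j
      rcases eq_or_ne j k with rfl | hj
      · simp
      · simp [hj]
    have hd : DiffContOnCl ℂ (fun w : ℂ => (F (Function.update u k w))⁻¹) (Metric.ball 0 1) := by
      apply DifferentiableOn.diffContOnCl
      rw [closure_ball _ one_ne_zero]
      intro w hw
      exact ((hF.comp hupd) w).differentiableWithinAt.inv
        (h0 _ (hle w (by simpa using hw)))
    have hmax := Complex.norm_le_of_forall_mem_frontier_norm_le (C := c⁻¹) Metric.isBounded_ball hd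
      (by
        intro w hw
        rw [frontier_ball _ one_ne_zero] at hw
        have hw1 : ‖w‖ = 1 := by simpa using hw
        rw [norm_inv]
        refine inv_anti₀ hc (ih _ (hle w hw1.le) fun j hj => ?_)
        rcases eq_or_ne j k with rfl | hjk
        · simpa using hw1
        · simpa [hjk] using hS j (by simp [hjk, hj]))
      (z := u k) (by rw [closure_ball _ one_ne_zero]; simpa using hu k)
    rw [Function.update_eq_self, norm_inv] at hmax
    exact (inv_le_inv₀ (norm_pos_iff.2 (h0 u hu)) hc).1 hmax

open Filter Topology in
/-- A polynomial with `f 0 ≠ 0` and without zeros on the tori `|z_j| = t ^ l_j`, `0 < t < 1`,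
has no zeros in the open unit polydisc. -/
theorem eval_ne_zero_of_tori {n : ℕ} (f : MvPolynomial (Fin n) ℂ) (l : Fin n → ℝ)
    (hl : ∀ j, 0 < l j) (hf0 : MvPolynomial.eval 0 f ≠ 0)
    (hT : ∀ t : ℝ, 0 < t → t < 1 → ∀ z : Fin n → ℂ, (∀ j, ‖z j‖ = t ^ l j) →
      MvPolynomial.eval z f ≠ 0)
    (z : Fin n → ℂ) (hz : ∀ j, ‖z j‖ < 1) : MvPolynomial.eval z f ≠ 0 := by
  have hpow : ∀ j, Continuous fun t : ℝ => t ^ l j := fun j =>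
    Real.continuous_rpow_const (hl j).le
  set sc : ℝ × (Fin n → ℂ) → Fin n → ℂ := fun y j => ((y.1 ^ l j : ℝ) : ℂ) * y.2 j with hsc
  have hsc_cont : Continuous sc := by
    refine continuous_pi fun j => ?_
    have := hpow j
    fun_prop
  have hG : Continuous fun y => MvPolynomial.eval (sc y) f :=
    (MvPolynomial.continuous_eval f).comp hsc_cont
  have hsc0 : ∀ u, sc (0, u) = 0 := by
    intro u
    ext j
    simp [hsc, Real.zero_rpow (hl j).ne']
  obtain ⟨t₀, ht₀pos, ht₀1, ht₀z⟩ : ∃ t₀ : ℝ, 0 < t₀ ∧ t₀ < 1 ∧ ∀ j, ‖z j‖ ≤ t₀ ^ l j := by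
    have h1 : ∀ᶠ t : ℝ in 𝓝[<] 1, ∀ j, ‖z j‖ ≤ t ^ l j := by
      rw [eventually_all]
      intro j
      have : Tendsto (fun t : ℝ => t ^ l j) (𝓝[<] 1) (𝓝 1) := by
        simpa using ((hpow j).tendsto 1).mono_left nhdsWithin_le_nhds
      exact (this.eventually_const_lt (hz j)).mono fun _ h => h.le
    have h2 : ∀ᶠ t : ℝ in 𝓝[<] 1, t ∈ Set.Ioo (0 : ℝ) 1 := Ioo_mem_nhdsLT one_pos
    obtain ⟨t, ha, hb⟩ := (h1.and h2).exists
    exact ⟨t, hb.1, hb.2, ha⟩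
  -- Including `t = 0`, where `sc` is `0`, makes `T` compact, so one bound `c > 0` serves all tori
  -- with `t ≤ t₀`.
  set T : Set (ℝ × (Fin n → ℂ)) := Set.Icc 0 t₀ ×ˢ Set.univ.pi fun _ => Metric.sphere 0 1 with hTdef
  have hTc : IsCompact T := isCompact_Icc.prod (isCompact_univ_pi fun _ => isCompact_sphere _ _)
  have hTne : T.Nonempty := ⟨(0, fun _ => 1), by simp [hTdef, ht₀pos.le]⟩
  obtain ⟨y₀, hy₀, hmin⟩ := hTc.exists_isMinOn hTne hG.norm.continuousOn
  have hc : 0 < ‖MvPolynomial.eval (sc y₀) f‖ := by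
    rw [norm_pos_iff]
    obtain ⟨t, u⟩ := y₀
    simp only [hTdef, Set.mem_prod, Set.mem_Icc, Set.mem_pi, Set.mem_univ, true_imp_iff,
      mem_sphere_iff_norm, sub_zero] at hy₀
    rcases hy₀.1.1.eq_or_lt with h | h
    · rw [← h, hsc0]; exact hf0
    · refine hT t h (hy₀.1.2.trans_lt ht₀1) _ fun j => ?_
      simp [hsc, hy₀.2 j, abs_of_pos (Real.rpow_pos_of_pos h (l j))]
  set c := ‖MvPolynomial.eval (sc y₀) f‖
  set Z : Set (ℝ × (Fin n → ℂ)) := (Set.Icc 0 t₀ ×ˢ Set.univ.pi fun _ => Metric.closedBall 0 1) ∩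
    {y | MvPolynomial.eval (sc y) f = 0} with hZdef
  have hZc : IsCompact Z :=
    (isCompact_Icc.prod (isCompact_univ_pi fun _ => isCompact_closedBall _ _)).inter_right
      (isClosed_eq hG continuous_const)
  have hmemZ : ∀ t u, (t, u) ∈ Z ↔
      ((0 ≤ t ∧ t ≤ t₀) ∧ ∀ j, ‖u j‖ ≤ 1) ∧ MvPolynomial.eval (sc (t, u)) f = 0 := by
    intro t u
    simp [hZdef, Set.mem_pi]
  intro hzero
  have hZne : Z.Nonempty := by
    refine ⟨(t₀, fun j => z j / ((t₀ ^ l j : ℝ) : ℂ)), (hmemZ _ _).2 ⟨⟨⟨ht₀pos.le, le_rfl⟩, ?_⟩, ?_⟩⟩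
    · intro j
      have := Real.rpow_pos_of_pos ht₀pos (l j)
      rw [norm_div, Complex.norm_real, Real.norm_of_nonneg this.le]
      exact (div_le_one this).2 (ht₀z j)
    · convert hzero using 3
      ext j
      have : ((t₀ ^ l j : ℝ) : ℂ) ≠ 0 := by
        exact_mod_cast (Real.rpow_pos_of_pos ht₀pos (l j)).ne'
      simp only [hsc]
      field_simp
  -- Take a zero with least `t`. Below `t₁` the closed polydiscs are zero-free, so the modulus stays
  -- at least `c`, contradicting continuity at `t₁`.
  obtain ⟨⟨t₁, u₁⟩, hy₁, hmin₁⟩ := hZc.exists_isMinOn hZne continuous_fst.continuousOn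
  obtain ⟨⟨⟨ht₁0, ht₁⟩, hu₁⟩, hz₁⟩ := (hmemZ _ _).1 hy₁
  have ht₁pos : 0 < t₁ := by
    refine ht₁0.lt_of_ne fun h => hf0 ?_
    rwa [← h, hsc0] at hz₁
  have hlow : ∀ t ∈ Set.Ioo 0 t₁, c ≤ ‖MvPolynomial.eval (sc (t, u₁)) f‖ := by
    intro t ht
    refine le_norm_on_polydisc (F := fun u => MvPolynomial.eval (sc (t, u)) f) ?_ hc ?_ ?_ u₁ hu₁
    · have h1 : Differentiable ℂ fun u => sc (t, u) := by
        rw [differentiable_pi]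
        intro j
        simp only [hsc]
        fun_prop
      have h2 : Differentiable ℂ fun x : Fin n → ℂ => MvPolynomial.eval x f := fun x =>
        (AnalyticOnNhd.eval_mvPolynomial f x trivial).differentiableAt
      exact h2.comp h1
    · intro u hu h
      exact ht.2.not_ge (hmin₁ ((hmemZ t u).2 ⟨⟨⟨ht.1.le, ht.2.le.trans ht₁⟩, hu⟩, h⟩))
    · intro u hu
      exact hmin (show (t, u) ∈ T by simp [hTdef, Set.mem_pi, hu, ht.1.le, ht.2.le.trans ht₁])
  have hlim : Tendsto (fun t => ‖MvPolynomial.eval (sc (t, u₁)) f‖) (𝓝[<] t₁)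
      (𝓝 ‖MvPolynomial.eval (sc (t₁, u₁)) f‖) :=
    ((hG.norm.comp (by fun_prop : Continuous fun t : ℝ => (t, u₁))).tendsto t₁).mono_left
      nhdsWithin_le_nhds
  have := ge_of_tendsto hlim (by
    filter_upwards [Ioo_mem_nhdsLT ht₁pos] with t ht using hlow t ht)
  rw [hz₁, norm_zero] at this
  exact this.not_gt hc

/-! ### Choice of the simplicial cone and of the dominant exponent -/

/-- A family spanning a linearly independent family of the same cardinality is linearly
independent. -/
theorem linearIndependent_of_eq_sum {n : ℕ} {l l' : Fin n → ℝ} (hl : LinearIndependent ℚ l)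
    (V : Fin n → Fin n → ℕ) (h : ∀ j, l j = ∑ k, (V j k : ℝ) * l' k) :
    LinearIndependent ℚ l' := by
  rw [linearIndependent_iff_card_le_finrank_span] at hl ⊢
  refine hl.trans ?_
  have : Module.Finite ℚ (Submodule.span ℚ (Set.range l')) :=
    Module.Finite.span_of_finite ℚ (Set.finite_range l')
  refine Submodule.finrank_mono (Submodule.span_le.2 ?_)
  rintro _ ⟨j, rfl⟩
  rw [h j]
  refine Submodule.sum_mem _ fun k _ => ?_
  rw [← nsmul_eq_mul]
  exact nsmul_mem (Submodule.subset_span (Set.mem_range_self k)) _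

/-- The positive vector `l` lies in the interior of simplicial cones spanned by natural vectors
arbitrarily close in direction to `l`: the columns of `V` pair positively with any finitely many
vectors that pair positively with `l`. -/
theorem exists_nat_matrix {n : ℕ} (l : Fin n → ℝ) (hl : ∀ j, 0 < l j)
    (B : Finset (Fin n → ℝ)) (hB : ∀ b ∈ B, 0 < ∑ j, l j * b j) :
    ∃ (V : Fin n → Fin n → ℕ) (l' : Fin n → ℝ), (∀ j, V j j ≠ 0) ∧ (∀ k, 0 < l' k) ∧
      (∀ j, l j = ∑ k, (V j k : ℝ) * l' k) ∧ ∀ b ∈ B, ∀ k, 0 < ∑ j, (V j k : ℝ) * b j := by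
  rcases Nat.eq_zero_or_pos n with rfl | hn
  · refine ⟨fun _ _ => 0, fun _ => 0, fun j => j.elim0, fun j => j.elim0, fun j => j.elim0,
      fun _ _ k => k.elim0⟩
  obtain ⟨N, hN⟩ : ∃ N : ℕ, ∀ b ∈ B, ∀ k, (∑ j, |b j|) - n * b k < N * ∑ j, l j * b j := by
    have : ∀ᶠ N : ℕ in Filter.atTop, ∀ b ∈ B, ∀ k : Fin n,
        (∑ j, |b j|) - n * b k < N * ∑ j, l j * b j := by
      rw [Filter.eventually_all_finset]
      intro b hb
      rw [Filter.eventually_all]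
      intro k
      exact (tendsto_natCast_atTop_atTop.atTop_mul_const (hB b hb)).eventually_gt_atTop _
    exact this.exists
  set a : Fin n → ℕ := fun j => ⌊N * l j⌋₊ with ha
  have ha1 : ∀ j, (a j : ℝ) ≤ N * l j := fun j =>
    Nat.floor_le (mul_nonneg N.cast_nonneg (hl j).le)
  have ha2 : ∀ j, N * l j < a j + 1 := fun j => Nat.lt_floor_add_one _
  have hn' : (0 : ℝ) < n := by exact_mod_cast hn
  set A : ℝ := ∑ j, (a j : ℝ) with hA
  set L : ℝ := ∑ j, l j with hL
  have hApos : 0 ≤ A := Finset.sum_nonneg fun j _ => Nat.cast_nonneg _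
  have hnA : 0 < n + A := by linarith
  have hLpos : 0 < L := by
    have : Nonempty (Fin n) := ⟨⟨0, hn⟩⟩
    exact Finset.sum_pos (fun j _ => hl j) Finset.univ_nonempty
  have hAlt : N * L < A + n := by
    have : Nonempty (Fin n) := ⟨⟨0, hn⟩⟩
    have := Finset.sum_lt_sum_of_nonempty (s := Finset.univ) Finset.univ_nonempty fun j _ => ha2 j
    simpa [← Finset.mul_sum, Finset.sum_add_distrib] using this
  have hcast : ∀ j k, ((a j + if j = k then n else 0 : ℕ) : ℝ) =
      a j + if j = k then (n : ℝ) else 0 := by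
    intro j k
    push_cast
    rfl
  -- Column `k` is `a + n e_k`. Summing the entries of `l = V l'` gives `∑ l' = L / (n + A)`, hence
  -- `l'`; it is positive since `a k ≤ N * l k` and `N * L < A + n`.
  refine ⟨fun j k => a j + if j = k then n else 0,
    fun k => (l k - L / (n + A) * a k) / n, fun j => ?_, fun k => ?_, fun j => ?_, fun b hb k => ?_⟩
  · simp [hn.ne']
  · refine div_pos ?_ hn'
    rw [sub_pos, div_mul_eq_mul_div, div_lt_iff₀ hnA]
    nlinarith [ha1 k, hl k]
  · simp only [hcast, add_mul, ite_mul, zero_mul, Finset.sum_add_distrib, Finset.sum_ite_eq,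
      Finset.mem_univ, if_true]
    rw [← Finset.mul_sum, ← Finset.sum_div, Finset.sum_sub_distrib, ← Finset.mul_sum, ← hA, ← hL]
    field_simp
    ring
  · simp only [hcast, add_mul, ite_mul, zero_mul, Finset.sum_add_distrib, Finset.sum_ite_eq',
      Finset.mem_univ, if_true]
    have h1 : ∑ j, (N * l j - a j) * b j ≤ ∑ j, |b j| := by
      refine Finset.sum_le_sum fun j _ => ?_
      have h1 := ha1 j
      have h2 := ha2 j
      calc (N * l j - a j) * b j ≤ (N * l j - a j) * |b j| :=
            mul_le_mul_of_nonneg_left (le_abs_self _) (by linarith)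
        _ ≤ 1 * |b j| := mul_le_mul_of_nonneg_right (by linarith) (abs_nonneg _)
        _ = |b j| := one_mul _
    have h2 : ∑ j, (N * l j - a j) * b j = N * ∑ j, l j * b j - ∑ j, (a j : ℝ) * b j := by
      rw [Finset.mul_sum, ← Finset.sum_sub_distrib]
      exact Finset.sum_congr rfl fun j _ => by ring
    linarith [hN b hb k]

/-- Over a `ℚ`-linearly independent vector of weights, the weight is maximized over the support of
a nonzero polynomial at exactly one exponent. -/
theorem exists_strict_max_exponent {n : ℕ} {p : MvPolynomial (Fin n) ℂ} (hp : p ≠ 0)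
    {l : Fin n → ℝ} (hl : LinearIndependent ℚ l) :
    ∃ m ∈ p.support, ∀ α ∈ p.support, α ≠ m → 0 < ∑ j, l j * ((m j : ℝ) - α j) := by
  obtain ⟨m, hm, hmax⟩ := p.support.exists_max_image (fun α => ∑ j, l j * (α j : ℝ))
    (MvPolynomial.support_nonempty.2 hp)
  refine ⟨m, hm, fun α hα hne => ?_⟩
  have heq : ∑ j, l j * ((m j : ℝ) - α j) = ∑ j, l j * (m j : ℝ) - ∑ j, l j * (α j : ℝ) := by
    simp only [mul_sub, Finset.sum_sub_distrib]
  refine lt_of_le_of_ne (by rw [heq]; linarith [hmax α hα]) fun h0 => hne ?_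
  -- A tie would be a rational relation among the `l j`.
  have := Fintype.linearIndependent_iff.1 hl (fun j => (m j : ℚ) - α j) (by
    rw [h0]
    refine Finset.sum_congr rfl fun j _ => ?_
    rw [Rat.smul_def]
    push_cast
    ring)
  ext j
  have hj := this j
  rw [sub_eq_zero] at hj
  exact_mod_cast hj.symm

/-! ### Monomial substitution and the Lee–Yang property -/

theorem eval_ne_zero_of_disjoint_amoeba {n : ℕ} {p : MvPolynomial (Fin n) ℂ} {l : Fin n → ℝ}
    (h : Disjoint {v : Fin n → ℝ | ∃ t : ℝ, t ≠ 0 ∧ v = t • l} (amoeba p)) {s : ℝ} (hs : s ≠ 0)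
    (z : Fin n → ℂ) (hz : ∀ j, ‖z j‖ = Real.exp (s * l j)) : MvPolynomial.eval z p ≠ 0 := by
  intro h0
  refine Set.disjoint_left.1 h ⟨s, hs, rfl⟩ ⟨z, ⟨fun j => ?_, h0⟩, ?_⟩
  · rw [← norm_ne_zero_iff, hz]
    exact (Real.exp_pos _).ne'
  · ext j
    simp [hz]

theorem norm_monomial_map {n : ℕ} {l l' : Fin n → ℝ} {V : Fin n → Fin n → ℕ}
    (hV : ∀ j, l j = ∑ k, (V j k : ℝ) * l' k) {s : ℝ} {z : Fin n → ℂ}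
    (hz : ∀ k, ‖z k‖ = Real.exp (s * l' k)) (j : Fin n) :
    ‖∏ k, z k ^ V j k‖ = Real.exp (s * l j) := by
  rw [norm_prod, hV j, Finset.mul_sum, Real.exp_sum]
  refine Finset.prod_congr rfl fun k _ => ?_
  rw [norm_pow, hz, ← Real.exp_nat_mul]
  ring_nf

theorem lemma2p5 (n : ℕ) (p : MvPolynomial (Fin n) ℂ) (hp : MvPolynomial.eval 0 p ≠ 0)
    (l : Fin n → ℝ) (hl_pos : ∀ j, 0 < l j) (hl_indep : LinearIndependent ℚ l)
    (h_amoeba : Disjoint {v : Fin n → ℝ | ∃ t : ℝ, t ≠ 0 ∧ v = t • l} (amoeba p)) :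
    ∃ (q : MvPolynomial (Fin n) ℂ) (l' : Fin n → ℝ),
      IsLeeYang q ∧ (∀ j, 0 < l' j) ∧ LinearIndependent ℚ l' ∧
        ∀ x : ℂ, MvPolynomial.eval (expLine l x) p = MvPolynomial.eval (expLine l' x) q := by
  have hp0 : p ≠ 0 := by
    rintro rfl
    simp at hp
  obtain ⟨m, hm, hmax⟩ := exists_strict_max_exponent hp0 hl_indep
  obtain ⟨V, l', hVd, hl', hV, hVB⟩ := exists_nat_matrix l hl_pos
    ((p.support.erase m).image fun α j => (m j : ℝ) - α j) (by
      intro b hb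
      obtain ⟨α, hα, rfl⟩ := Finset.mem_image.1 hb
      exact hmax α (Finset.mem_of_mem_erase hα) (Finset.ne_of_mem_erase hα))
  have hlt : ∀ α ∈ p.support, α ≠ m → ∀ k, ∑ j, V j k * α j < ∑ j, V j k * m j := by
    intro α hα hne k
    have := hVB _ (Finset.mem_image_of_mem _ (Finset.mem_erase.2 ⟨hne, hα⟩)) k
    simp only [mul_sub, Finset.sum_sub_distrib, sub_pos] at this
    exact_mod_cast this
  have hle : ∀ α ∈ p.support, ∀ k, ∑ j, V j k * α j ≤ ∑ j, V j k * m j := by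
    intro α hα k
    rcases eq_or_ne α m with rfl | hne
    · exact le_rfl
    · exact (hlt α hα hne k).le
  set q : MvPolynomial (Fin n) ℂ :=
    MvPolynomial.bind₁ (fun j => ∏ k, MvPolynomial.X k ^ V j k) p with hq
  have hqe : ∀ z : Fin n → ℂ, MvPolynomial.eval z q =
      MvPolynomial.eval (fun j => ∏ k, z k ^ V j k) p := by
    intro z
    rw [hq, MvPolynomial.eval, MvPolynomial.eval₂Hom_bind₁]
    congr 2
    funext j
    change MvPolynomial.eval z _ = _
    simp
  -- The reversal of `q`; by `hle` no subtraction truncates.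
  set r : MvPolynomial (Fin n) ℂ := ∑ α ∈ p.support, MvPolynomial.C (p.coeff α) *
    ∏ k, MvPolynomial.X k ^ (∑ j, V j k * m j - ∑ j, V j k * α j) with hr
  have hre : ∀ z : Fin n → ℂ, MvPolynomial.eval z r = ∑ α ∈ p.support, p.coeff α *
      ∏ k, z k ^ (∑ j, V j k * m j - ∑ j, V j k * α j) := by
    intro z
    simp [hr]
  have hqr : ∀ z : Fin n → ℂ, (∀ k, z k ≠ 0) → MvPolynomial.eval z q =
      (∏ k, z k ^ ∑ j, V j k * m j) * MvPolynomial.eval (fun k => (z k)⁻¹) r := by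
    intro z hz
    rw [hqe, MvPolynomial.eval_eq', hre, Finset.mul_sum]
    refine Finset.sum_congr rfl fun α hα => ?_
    rw [mul_left_comm, ← Finset.prod_mul_distrib]
    congr 1
    rw [Finset.prod_congr rfl fun j _ => (Finset.prod_pow Finset.univ (α j) _).symm,
      Finset.prod_comm]
    refine Finset.prod_congr rfl fun k _ => ?_
    simp only [← pow_mul]
    rw [Finset.prod_pow_eq_pow_sum, inv_pow, ← div_eq_mul_inv, eq_div_iff (pow_ne_zero _ (hz k)),
      ← pow_add, Nat.add_sub_cancel' (hle α hα k)]
  -- Each substituted monomial vanishes at `0` because `V j j ≠ 0`.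
  have hq0 : MvPolynomial.eval 0 q ≠ 0 := by
    rw [hqe]
    convert hp using 3
    ext j
    exact Finset.prod_eq_zero (Finset.mem_univ j) (by simp [hVd j])
  have hexp : ∀ t : ℝ, 0 < t → ∀ a : ℝ, t ^ a = Real.exp (Real.log t * a) := fun t ht a =>
    Real.rpow_def_of_pos ht a
  have hqT : ∀ s : ℝ, s ≠ 0 → ∀ z : Fin n → ℂ, (∀ k, ‖z k‖ = Real.exp (s * l' k)) →
      MvPolynomial.eval z q ≠ 0 := by
    intro s hs z hz
    rw [hqe]
    exact eval_ne_zero_of_disjoint_amoeba h_amoeba hs _ (norm_monomial_map hV hz)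
  refine ⟨q, l', ⟨?_, ?_⟩, hl', linearIndependent_of_eq_sum hl_indep V hV, fun x => ?_⟩
  · refine eval_ne_zero_of_tori q l' hl' hq0 fun t ht ht1 z hz => ?_
    exact hqT _ (Real.log_neg ht ht1).ne z fun k => by rw [hz, hexp t ht]
  · intro z hz
    have hz0 : ∀ k, z k ≠ 0 := fun k => norm_pos_iff.1 (one_pos.trans (hz k))
    rw [hqr z hz0]
    refine mul_ne_zero (Finset.prod_ne_zero_iff.2 fun k _ => pow_ne_zero _ (hz0 k)) ?_
    refine eval_ne_zero_of_tori r l' hl' ?_ (fun t ht ht1 w hw => ?_) _ fun k => ?_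
    · rw [hre, Finset.sum_eq_single_of_mem m hm]
      · simpa using hm
      · intro α hα hne
        have hn : ∃ k : Fin n, True := by
          by_contra! h
          exact hne (by ext k; exact (h k).elim)
        obtain ⟨k, -⟩ := hn
        rw [Finset.prod_eq_zero (Finset.mem_univ k), mul_zero]
        exact zero_pow (Nat.sub_pos_of_lt (hlt α hα hne k)).ne'
    · have hw0 : ∀ k, w k ≠ 0 := fun k => by
        rw [← norm_pos_iff, hw]
        exact Real.rpow_pos_of_pos ht _
      -- Inversion sends the torus of parameter `t < 1` to the one with `s = -log t > 0`.
      have := hqT _ (neg_ne_zero.2 (Real.log_neg ht ht1).ne) (fun k => (w k)⁻¹) fun k => by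
        rw [norm_inv, hw, hexp t ht, ← Real.exp_neg, neg_mul]
      rw [hqr _ fun k => inv_ne_zero (hw0 k)] at this
      simpa using right_ne_zero_of_mul this
    · rw [norm_inv]
      exact inv_lt_one_of_one_lt₀ (hz k)
  · rw [hqe]
    congr 2
    ext j
    simp only [expLine, hV j]
    rw [Complex.ofReal_sum, Finset.mul_sum, Complex.exp_sum]
    refine Finset.prod_congr rfl fun k _ => ?_
    rw [← Complex.exp_nat_mul]
    push_cast
    ring_nf
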